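/- **Theorem (Convergence).** Let $\mathcal X\subseteq\mathbb R^n$ be open and convex, let $\le$ be the componentwise order and $\mathbf 1=(1,\dots,1)$. Let $f$ be of class $C^1$ on $\mathcal X$, and consider either the continuous-time system $\dot x=f(x)$, with $f:\mathcal X\to\mathbb R^n$ and time set $\mathbb T=\mathbb R_{\ge 0}$, or the discrete-time system $x(k+1)=f(x(k))$, with $f:\mathcal X\to\mathcal X$ and $\mathbb T=\mathbb N$. Write $\varphi(t,\xi)\in\mathcal X$ for the state at time $t\in\mathbb T$ of the solution in $\mathcal X$ that starts at $\xi\in\mathcal X$ (in continuous time it is not assumed in advance that solutions exist for all times). Suppose that the system is *K-topical*, that is, whenever the states involved are defined, 1. (type-K monotonicity) $\xi_1\le\xi_2$ implies $\varphi(t,\xi_1)\le\varphi(t,\xi_2)$ and, for each $i$ with $\xi_{1,i}<\xi_{2,i}$, also $\varphi_i(t,\xi_1)<\varphi_i(t,\xi_2)$; 2. (plus-homogeneity) $\varphi(t,\xi+\alpha\mathbf 1)=\varphi(t,\xi)+\alpha\mathbf 1$ for all $\alpha\in\mathbb R$, the left side being defined (and in particular $\xi+\alpha\mathbf 1\in\mathcal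 X$) whenever $\varphi(t,\xi)$ is. Suppose also that the set of equilibrium points $\mathcal F=\{x\in\mathcal X:\varphi(t,x)=x\ \forall t\in\mathbb T\}$ is not empty. Then for every $\xi\in\mathcal X$ whose trajectory $\{\varphi(t,\xi)\}$ has its closure in $\mathbb R^n$ contained in $\mathcal X$ (for $\mathcal X=\mathbb R^n$ this is every $\xi$), the state $\varphi(t,\xi)$ exists and is unique for all $t\in\mathbb T$, and there is a stable equilibrium point $x_\xi\in\mathcal F$ with $$\lim_{t\to\infty}\varphi(t,\xi)=x_\xi .$$ Here $x_e\in\mathcal F$ is *stable* if for every $\varepsilon>0$ there is $\delta>0$ such that for all $\xi\in\mathcal X$ with $\|\xi-x_e\|<\delta$ and all $t\in\mathbb T$ the state $\varphi(t,\xi)$ is defined and $\|\varphi(t,\xi)-x_e\|<\varepsilon$. -/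

import Mathlib

open Set Filter
open scoped Topology NNReal

namespace KTop

/-- A (possibly only partially defined) flow on `ℝⁿ` with time set `τ`, given by its graph:
`Φ t ξ y` says that `φ(t, ξ)` is defined and equal to `y`. -/
abbrev FlowRel (τ : Type) (n : ℕ) : Type := τ → (Fin n → ℝ) → (Fin n → ℝ) → Prop

/-- `x` solves `x' = f(x)` on `[0, T]` and stays in the state space `X` there
(one-sided derivatives at the end points). -/
def SolvesOn {n : ℕ} (f : (Fin n → ℝ) → (Fin n → ℝ)) (X : Set (Fin n → ℝ))
    (T : ℝ) (x : ℝ → (Fin n → ℝ)) : Prop :=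
  ∀ s ∈ Icc (0 : ℝ) T, x s ∈ X ∧ HasDerivWithinAt x (f (x s)) (Icc (0 : ℝ) T) s

/-- The flow of the continuous-time system `x' = f(x)` on `X`: `φ(t, ξ) = y` when some solution
in `X` on `[0, t]` starts at `ξ` and is at `y` at time `t`. Existence for all times is not
built in. -/
def contFlow {n : ℕ} (f : (Fin n → ℝ) → (Fin n → ℝ)) (X : Set (Fin n → ℝ)) : FlowRel ℝ≥0 n :=
  fun t ξ y => ∃ x : ℝ → (Fin n → ℝ), SolvesOn f X t x ∧ x 0 = ξ ∧ x t = y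

/-- The flow of the discrete-time system `x(k+1) = f(x(k))` on `X`: `φ(k, ξ) = f^k(ξ)`. -/
def discFlow {n : ℕ} (f : (Fin n → ℝ) → (Fin n → ℝ)) (X : Set (Fin n → ℝ)) : FlowRel ℕ n :=
  fun k ξ y => ξ ∈ X ∧ y = f^[k] ξ

/-- `ξ₁ ≤ ξ₂` implies `φ(t, ξ₁) ≤ φ(t, ξ₂)`, at every time at which both sides are defined. -/
def IsMonotone {τ : Type} {n : ℕ} (Φ : FlowRel τ n) : Prop :=
  ∀ (t : τ) (ξ₁ ξ₂ y₁ y₂ : Fin n → ℝ), Φ t ξ₁ y₁ → Φ t ξ₂ y₂ → ξ₁ ≤ ξ₂ → y₁ ≤ y₂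

/-- Type-K monotone: monotone, and for ordered initial conditions `ξ₁ ≤ ξ₂` a strict inequality
in the `i`-th component is preserved. -/
def TypeKMonotone {τ : Type} {n : ℕ} (Φ : FlowRel τ n) : Prop :=
  IsMonotone Φ ∧
    ∀ (t : τ) (ξ₁ ξ₂ y₁ y₂ : Fin n → ℝ), Φ t ξ₁ y₁ → Φ t ξ₂ y₂ → ξ₁ ≤ ξ₂ →
      ∀ i : Fin n, ξ₁ i < ξ₂ i → y₁ i < y₂ i

/-- `φ(t, ξ + α𝟏) = φ(t, ξ) + α𝟏` for all real `α`, where the left side is defined as soon as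
`φ(t, ξ)` is. -/
def PlusHomogeneous {τ : Type} {n : ℕ} (Φ : FlowRel τ n) : Prop :=
  ∀ (t : τ) (ξ y : Fin n → ℝ) (α : ℝ), Φ t ξ y → Φ t (fun i => ξ i + α) (fun i => y i + α)

def KTopical {τ : Type} {n : ℕ} (Φ : FlowRel τ n) : Prop :=
  TypeKMonotone Φ ∧ PlusHomogeneous Φ

/-- The equilibrium points: `φ(t, ξ) = ξ` at all times. -/
def equilibria {τ : Type} {n : ℕ} (Φ : FlowRel τ n) : Set (Fin n → ℝ) :=
  {ξ | ∀ t : τ, Φ t ξ ξ}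

/-- Lyapunov stability of `e`; `‖·‖` is the sup norm, and every norm on `ℝⁿ` gives the same
notion. The flow is required to be defined for all times near `e`. -/
def IsStable {τ : Type} {n : ℕ} (X : Set (Fin n → ℝ)) (Φ : FlowRel τ n) (e : Fin n → ℝ) : Prop :=
  ∀ ε > (0 : ℝ), ∃ δ > (0 : ℝ), ∀ ξ ∈ X, ‖ξ - e‖ < δ →
    ∀ t : τ, ∃ y : Fin n → ℝ, Φ t ξ y ∧ ‖y - e‖ < ε

/-- The set of all states `φ(t, ξ)` on the trajectory of `ξ`. -/
def trajectory {τ : Type} {n : ℕ} (Φ : FlowRel τ n) (ξ : Fin n → ℝ) : Set (Fin n → ℝ) :=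
  {y | ∃ t : τ, Φ t ξ y}

/-- `φ(t, ξ)` exists and is unique for all times `t`, and tends to `e` as `t → ∞`. -/
def ConvergesTo {τ : Type} [Preorder τ] {n : ℕ} (Φ : FlowRel τ n) (ξ e : Fin n → ℝ) : Prop :=
  ∃ x : τ → (Fin n → ℝ), (∀ (t : τ) (y : Fin n → ℝ), Φ t ξ y ↔ y = x t) ∧
    Tendsto x atTop (𝓝 e)

end KTop

/-!
The flow of a K-topical system is single-valued and nonexpansive for the sup norm: comparing
`ξ₁` with `ξ₂ + ‖ξ₁ - ξ₂‖ 𝟏` and using monotonicity and plus-homogeneity gives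
`‖φ(t, ξ₁) - φ(t, ξ₂)‖ ≤ ‖ξ₁ - ξ₂‖` (`KTopical.norm_sub_le`). Hence equilibria are stable, an
equilibrium keeps every trajectory bounded, and a trajectory converges as soon as one of its cluster
points is an equilibrium.

Every cluster point `z` is in fact an equilibrium (`KTopical.apply_eq_of_tendsto`). Fix a time `t`.
Along the given trajectory, `maxᵢ (φᵢ(s, ξ) - φᵢ(s + t, ξ))` is nonincreasing in `s` and bounded,
so along the trajectory of `z` this maximum is a constant `c`. By type-K monotonicity, a coordinate
that does not attain the maximum at some time does not attain it later either; the sets of maximizing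
coordinates therefore decrease, and, being finite and nonempty, they share a coordinate `i`
(`KTopical.exists_coord_sub_eq_const`). Then `φᵢ(k t, z) = zᵢ - k c` for all natural numbers `k`, and
boundedness forces `c = 0`, that is, `z ≤ φ(t, z)`. The same argument with the two trajectories
exchanged gives `φ(t, z) ≤ z`.

The argument is carried out for the two time sets at once, for relations satisfying `IsLocalFlow`.
In continuous time, this requires concatenation of solutions and existence for all times of
trajectories that stay in a compact subset of `X`; the latter holds because the existence time in the
Picard–Lindelöf theorem is bounded below on compact sets.
-/

namespace KTop

/-! ### K-topical local flows -/

section Abstract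

variable {τ : Type} {n : ℕ} {Φ : FlowRel τ n} {X : Set (Fin n → ℝ)}

/-- Monotonicity, applied in both directions to a single initial state, makes the flow
single-valued. -/
lemma IsMonotone.unique (h : IsMonotone Φ) {t : τ} {ξ y y' : Fin n → ℝ}
    (hy : Φ t ξ y) (hy' : Φ t ξ y') : y = y' :=
  le_antisymm (h t ξ ξ y y' hy hy' le_rfl) (h t ξ ξ y' y hy' hy le_rfl)

lemma KTopical.le_add_const (h : KTopical Φ) {t : τ} {ξ₁ ξ₂ y₁ y₂ : Fin n → ℝ} {c : ℝ}
    (h₁ : Φ t ξ₁ y₁) (h₂ : Φ t ξ₂ y₂) (hle : ∀ i, ξ₁ i ≤ ξ₂ i + c) (i : Fin n) :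
    y₁ i ≤ y₂ i + c :=
  h.1.1 t ξ₁ _ y₁ _ h₁ (h.2 t ξ₂ y₂ c h₂) hle i

lemma KTopical.lt_add_const (h : KTopical Φ) {t : τ} {ξ₁ ξ₂ y₁ y₂ : Fin n → ℝ} {c : ℝ}
    (h₁ : Φ t ξ₁ y₁) (h₂ : Φ t ξ₂ y₂) (hle : ∀ i, ξ₁ i ≤ ξ₂ i + c) {i : Fin n}
    (hi : ξ₁ i < ξ₂ i + c) : y₁ i < y₂ i + c :=
  h.1.2 t ξ₁ _ y₁ _ h₁ (h.2 t ξ₂ y₂ c h₂) hle i hi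

/-- A K-topical flow is nonexpansive for the sup norm. -/
lemma KTopical.norm_sub_le (h : KTopical Φ) {t : τ} {ξ₁ ξ₂ y₁ y₂ : Fin n → ℝ}
    (h₁ : Φ t ξ₁ y₁) (h₂ : Φ t ξ₂ y₂) : ‖y₁ - y₂‖ ≤ ‖ξ₁ - ξ₂‖ := by
  have key : ∀ i, |ξ₁ i - ξ₂ i| ≤ ‖ξ₁ - ξ₂‖ := fun i => norm_le_pi_norm (ξ₁ - ξ₂) i
  refine (pi_norm_le_iff_of_nonneg (norm_nonneg _)).2 fun i => ?_
  have a₁ := h.le_add_const h₁ h₂ (c := ‖ξ₁ - ξ₂‖)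
    (fun i => by linarith [(abs_le.1 (key i)).2]) i
  have a₂ := h.le_add_const h₂ h₁ (c := ‖ξ₁ - ξ₂‖)
    (fun i => by linarith [(abs_le.1 (key i)).1]) i
  rw [Pi.sub_apply, Real.norm_eq_abs, abs_le]
  constructor <;> linarith

/-- The properties of a partially defined flow used for convergence: the semigroup law, including
the fact that a trajectory defined up to time `s + t` is defined up to time `s`, and existence for
all times of any trajectory that remains in a compact subset of the state space. Uniqueness is not
required, since monotonicity implies it. -/
structure IsLocalFlow [AddMonoid τ] (X : Set (Fin n → ℝ)) (Φ : FlowRel τ n) : Prop where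
  zero : ∀ ξ ∈ X, Φ 0 ξ ξ
  add_iff : ∀ (s t : τ) (ξ w : Fin n → ℝ), Φ (s + t) ξ w ↔ ∃ y, Φ s ξ y ∧ Φ t y w
  exists_of_isCompact : ∀ K : Set (Fin n → ℝ), IsCompact K → K ⊆ X → ∀ ξ ∈ X,
    trajectory Φ ξ ⊆ K → ∀ t, ∃ y, Φ t ξ y

lemma IsLocalFlow.shift [AddMonoid τ] (hΦ : IsLocalFlow X Φ) (hm : IsMonotone Φ)
    {ξ : Fin n → ℝ} {x : τ → Fin n → ℝ} (hx : ∀ t, Φ t ξ (x t)) (s t : τ) :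
    Φ t (x s) (x (s + t)) := by
  obtain ⟨y, hy, hyt⟩ := (hΦ.add_iff s t ξ _).1 (hx (s + t))
  rwa [hm.unique (hx s) hy]

/-- An equilibrium has compact sup-norm balls inside the open set `X`, and these are forward
invariant by nonexpansiveness; hence nearby trajectories exist for all times and stay close. -/
lemma KTopical.isStable [AddMonoid τ] (h : KTopical Φ) (hΦ : IsLocalFlow X Φ) (hX : IsOpen X)
    {e : Fin n → ℝ} (he : e ∈ equilibria Φ) (heX : e ∈ X) : IsStable X Φ e := by
  intro ε hε
  obtain ⟨r, hr, hrX⟩ := Metric.isOpen_iff.1 hX e heX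
  refine ⟨min ε r, lt_min hε hr, fun ξ hξ hd t => ?_⟩
  have hsub : trajectory Φ ξ ⊆ Metric.closedBall e ‖ξ - e‖ := by
    rintro y ⟨s, hs⟩
    rw [Metric.mem_closedBall, dist_eq_norm]
    exact h.norm_sub_le hs (he s)
  have hball : Metric.closedBall e ‖ξ - e‖ ⊆ X :=
    (Metric.closedBall_subset_ball (hd.trans_le (min_le_right _ _))).trans hrX
  obtain ⟨y, hy⟩ := hΦ.exists_of_isCompact _ (isCompact_closedBall _ _) hball ξ hξ hsub t
  exact ⟨y, hy, (h.norm_sub_le hy (he t)).trans_lt (hd.trans_le (min_le_left _ _))⟩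

/-- Let `A` and `B` be limits of the time shifts of two trajectories `u` and `v`. The largest
coordinate of `u - v` decreases to some `c`, so that of `A - B` is `c` at all times. By
type-K monotonicity, the set of coordinates where `A - B` attains `c` can only shrink with time,
and, being finite and nonempty, it never loses some coordinate `i`. -/
lemma KTopical.exists_coord_sub_eq_const [AddCommMonoid τ] [LinearOrder τ] [CanonicallyOrderedAdd τ]
    [Nonempty (Fin n)] (h : KTopical Φ) {U : Filter τ} [U.NeBot] (hU : U ≤ atTop)
    {u v A B : τ → Fin n → ℝ} {M : ℝ} (hM : ∀ s, ‖u s - v s‖ ≤ M)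
    (hu : ∀ s t, Φ t (u s) (u (s + t))) (hv : ∀ s t, Φ t (v s) (v (s + t)))
    (hA : ∀ s t, Φ t (A s) (A (s + t))) (hB : ∀ s t, Φ t (B s) (B (s + t)))
    (huA : ∀ t, Tendsto (fun s => u (s + t)) U (𝓝 (A t)))
    (hvB : ∀ t, Tendsto (fun s => v (s + t)) U (𝓝 (B t))) :
    ∃ c : ℝ, (∀ t i, A t i ≤ B t i + c) ∧ ∃ i, ∀ t, A t i = B t i + c := by
  let g : (Fin n → ℝ) → ℝ := fun w => Finset.univ.sup' Finset.univ_nonempty w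
  have hle : ∀ w i, w i ≤ g w := fun w i => Finset.le_sup' w (Finset.mem_univ i)
  have hanti : Antitone fun s => g (u s - v s) := by
    intro s s' hss
    obtain ⟨t, rfl⟩ := le_iff_exists_add.1 hss
    refine Finset.sup'_le _ _ fun i _ => ?_
    have := h.le_add_const (hu s t) (hv s t) (c := g (u s - v s))
      (fun j => by linarith [hle (u s - v s) j, Pi.sub_apply (u s) (v s) j]) i
    rw [Pi.sub_apply]
    linarith
  have hbdd : BddBelow (Set.range fun s => g (u s - v s)) := by
    refine ⟨-M, ?_⟩
    rintro _ ⟨s, rfl⟩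
    obtain ⟨i⟩ := ‹Nonempty (Fin n)›
    have h1 := (abs_le.1 ((norm_le_pi_norm (u s - v s) i).trans (hM s))).1
    exact h1.trans (hle _ i)
  have hlim := tendsto_atTop_ciInf hanti hbdd
  set c := ⨅ s, g (u s - v s)
  have hc : ∀ t, g (A t - B t) = c := by
    intro t
    have hshift : Tendsto (fun s : τ => s + t) U atTop :=
      (tendsto_atTop_mono (fun s => le_self_add) tendsto_id).mono_left hU
    have h1 : Tendsto (fun s => g (u (s + t) - v (s + t))) U (𝓝 c) := hlim.comp hshift
    have h2 : Tendsto (fun s => g (u (s + t) - v (s + t))) U (𝓝 (g (A t - B t))) := by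
      have := Tendsto.finset_sup'_nhds Finset.univ_nonempty (s := (Finset.univ : Finset (Fin n)))
        (f := fun i s => (u (s + t) - v (s + t)) i) (g := A t - B t) (l := U)
        (fun i _ => (tendsto_pi_nhds.1 ((huA t).sub (hvB t))) i)
      refine this.congr fun s => ?_
      simp [g, Finset.sup'_apply]
    exact tendsto_nhds_unique h2 h1
  have hAB : ∀ t i, A t i ≤ B t i + c := fun t i => by
    have := hle (A t - B t) i
    rw [hc t, Pi.sub_apply] at this
    linarith
  refine ⟨c, hAB, ?_⟩
  by_contra! hcon
  choose T hT using hcon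
  -- After the latest of the times `T i`, no coordinate would attain the maximum.
  let S := Finset.univ.sup' Finset.univ_nonempty T
  obtain ⟨i, -, hi⟩ := Finset.exists_mem_eq_sup' Finset.univ_nonempty (A S - B S)
  have hi' : A S i = B S i + c := by
    have : g (A S - B S) = A S i - B S i := hi
    rw [hc S] at this
    linarith
  obtain ⟨t, ht⟩ := le_iff_exists_add.1 (Finset.le_sup' T (Finset.mem_univ i) : T i ≤ S)
  have := h.lt_add_const (hA (T i) t) (hB (T i) t) (hAB (T i))
    (lt_of_le_of_ne (hAB (T i) i) (hT i))
  rw [← ht, hi'] at this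
  exact lt_irrefl _ this

lemma eq_zero_of_nsmul_bounded {c a M : ℝ} {z : ℕ → ℝ} (hM : ∀ k, |z k| ≤ M)
    (hz : ∀ k : ℕ, z k = a + k * c) : c = 0 := by
  by_contra hc
  obtain ⟨k, hk⟩ := exists_nat_gt ((M + |a|) / |c|)
  rw [div_lt_iff₀ (abs_pos.2 hc)] at hk
  have h1 : |(k : ℝ) * c| ≤ |z k| + |a| := by
    rw [show (k : ℝ) * c = z k - a by rw [hz]; ring]
    exact abs_sub _ _
  rw [abs_mul, Nat.abs_cast] at h1
  linarith [hM k]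

/-- A cluster point of a bounded trajectory is an equilibrium, as soon as the flow is defined on it
for all times. -/
lemma KTopical.apply_eq_of_tendsto [AddCommMonoid τ] [LinearOrder τ] [CanonicallyOrderedAdd τ]
    (h : KTopical Φ) {U : Filter τ} [U.NeBot] (hU : U ≤ atTop) {x Z : τ → Fin n → ℝ} {M : ℝ}
    (hM : ∀ s, ‖x s‖ ≤ M) (hx : ∀ s t, Φ t (x s) (x (s + t)))
    (hZ : ∀ s t, Φ t (Z s) (Z (s + t)))
    (hxZ : ∀ t, Tendsto (fun s => x (s + t)) U (𝓝 (Z t))) (t : τ) : Z t = Z 0 := by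
  rcases isEmpty_or_nonempty (Fin n) with hn | hn
  · exact Subsingleton.elim _ _
  have hZM : ∀ s, ‖Z s‖ ≤ M := fun s =>
    le_of_tendsto (hxZ s).norm (Eventually.of_forall fun _ => hM _)
  have hdiff : ∀ s s', ‖x s - x s'‖ ≤ M + M := fun s s' =>
    (_root_.norm_sub_le _ _).trans (add_le_add (hM _) (hM _))
  have hx' : ∀ s r, Φ r (x (s + t)) (x (s + r + t)) := fun s r => by
    rw [add_right_comm]; exact hx _ _
  have hZ' : ∀ s r, Φ r (Z (s + t)) (Z (s + r + t)) := fun s r => by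
    rw [add_right_comm]; exact hZ _ _
  have hxZ' : ∀ r, Tendsto (fun s => x (s + r + t)) U (𝓝 (Z (r + t))) := fun r => by
    simpa only [add_assoc] using hxZ (r + t)
  have hcoord : ∀ (i : Fin n) (k : ℕ), |Z (k • t) i| ≤ M := fun i k =>
    (norm_le_pi_norm (Z (k • t)) i).trans (hZM _)
  obtain ⟨c, hc, i, hi⟩ := h.exists_coord_sub_eq_const hU (fun s => hdiff s (s + t))
    hx hx' hZ hZ' hxZ hxZ'
  obtain ⟨d, hd, j, hj⟩ := h.exists_coord_sub_eq_const hU (fun s => hdiff (s + t) s)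
    hx' hx hZ' hZ hxZ' hxZ
  -- A coordinate drifting by a constant amount per time `t` would be unbounded.
  have hc0 : -c = 0 := by
    refine eq_zero_of_nsmul_bounded (hcoord i) (a := Z 0 i) fun k => ?_
    induction k with
    | zero => simp
    | succ k ih =>
      have := hi (k • t)
      rw [succ_nsmul]; push_cast; linarith
  have hd0 : d = 0 := by
    refine eq_zero_of_nsmul_bounded (hcoord j) (a := Z 0 j) fun k => ?_
    induction k with
    | zero => simp
    | succ k ih =>
      have := hj (k • t)
      rw [succ_nsmul]; push_cast; linarith
  funext l
  have h1 := hc 0 l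
  have h2 := hd 0 l
  simp only [zero_add] at h1 h2
  linarith

/-- A trajectory of a K-topical local flow whose closure lies in the open state space converges to
a stable equilibrium, provided that there is some equilibrium to keep it bounded. -/
theorem KTopical.exists_isStable_convergesTo [AddCommMonoid τ] [LinearOrder τ]
    [CanonicallyOrderedAdd τ] (h : KTopical Φ) (hΦ : IsLocalFlow X Φ) (hX : IsOpen X)
    (hne : (equilibria Φ).Nonempty) {ξ : Fin n → ℝ} (hξ : ξ ∈ X)
    (hcl : closure (trajectory Φ ξ) ⊆ X) :
    ∃ e ∈ equilibria Φ, IsStable X Φ e ∧ ConvergesTo Φ ξ e := by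
  obtain ⟨e, he⟩ := hne
  set K := closure (trajectory Φ ξ)
  have hbdd : trajectory Φ ξ ⊆ Metric.closedBall e ‖ξ - e‖ := by
    rintro y ⟨s, hs⟩
    rw [Metric.mem_closedBall, dist_eq_norm]
    exact h.norm_sub_le hs (he s)
  have hKc : IsCompact K := (Metric.isBounded_closedBall.subset hbdd).isCompact_closure
  choose x hx using hΦ.exists_of_isCompact K hKc hcl ξ hξ subset_closure
  have hxs := hΦ.shift h.1.1 hx
  have hxK : ∀ s, x s ∈ K := fun s => subset_closure ⟨s, hx s⟩
  obtain ⟨z, hzK, hz⟩ := hKc.exists_mapClusterPt (f := atTop) (u := x)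
    (le_principal_iff.2 (mem_map.2 (Eventually.of_forall hxK)))
  obtain ⟨U, hU, hUz⟩ := mapClusterPt_iff_ultrafilter.1 hz
  have hlim : ∀ t y, Φ t z y → Tendsto (fun s => x (s + t)) U (𝓝 y) := by
    intro t y hy
    rw [tendsto_iff_norm_sub_tendsto_zero] at hUz ⊢
    exact squeeze_zero (fun _ => norm_nonneg _) (fun s => h.norm_sub_le (hxs s t) hy) hUz
  have hzsub : trajectory Φ z ⊆ K := by
    rintro y ⟨t, hy⟩
    exact isClosed_closure.mem_of_tendsto (hlim t y hy) (Eventually.of_forall fun s => hxK _)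
  choose Z hZ using hΦ.exists_of_isCompact K hKc hcl z (hcl hzK) hzsub
  obtain ⟨M, hM⟩ := hKc.isBounded.exists_norm_le
  have hZ0 : Z 0 = z := h.1.1.unique (hZ 0) (hΦ.zero z (hcl hzK))
  have hze : z ∈ equilibria Φ := fun t => by
    have := h.apply_eq_of_tendsto hU (fun s => hM _ (hxK s)) hxs (hΦ.shift h.1.1 hZ)
      (fun t => hlim t _ (hZ t)) t
    rw [hZ0] at this
    simpa [this] using hZ t
  refine ⟨z, hze, h.isStable hΦ hX hze (hcl hzK), x,
    fun t y => ⟨fun hy => h.1.1.unique hy (hx t), fun hy => hy ▸ hx t⟩, ?_⟩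
  -- The distance to `z` does not increase, and it is arbitrarily small along `U`.
  rw [Metric.tendsto_nhds]
  intro ε hε
  obtain ⟨s, hs⟩ := (hUz.eventually (Metric.ball_mem_nhds z hε)).exists
  filter_upwards [eventually_ge_atTop s] with s' hs'
  obtain ⟨t, rfl⟩ := le_iff_exists_add.1 hs'
  replace hs : ‖x s - z‖ < ε := by rwa [← dist_eq_norm]
  rw [dist_eq_norm]
  exact (h.norm_sub_le (hxs s t) (hze t)).trans_lt hs

end Abstract

/-! ### The discrete-time and the continuous-time flow -/

variable {n : ℕ} {f : (Fin n → ℝ) → (Fin n → ℝ)} {X : Set (Fin n → ℝ)}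

lemma isLocalFlow_discFlow (hf : MapsTo f X X) : IsLocalFlow X (discFlow f X) where
  zero ξ hξ := ⟨hξ, rfl⟩
  add_iff s t ξ w := by
    simp only [discFlow]
    constructor
    · rintro ⟨hξ, rfl⟩
      exact ⟨_, ⟨hξ, rfl⟩, hf.iterate s hξ, by rw [add_comm, Function.iterate_add_apply]⟩
    · rintro ⟨_, ⟨hξ, rfl⟩, -, rfl⟩
      exact ⟨hξ, by rw [add_comm, Function.iterate_add_apply]⟩
  exists_of_isCompact _ _ _ ξ hξ _ t := ⟨_, hξ, rfl⟩

lemma SolvesOn.mono {S T : ℝ} {x : ℝ → Fin n → ℝ} (hx : SolvesOn f X T x) (hST : S ≤ T) :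
    SolvesOn f X S x := fun s hs =>
  ⟨(hx s ⟨hs.1, hs.2.trans hST⟩).1,
    (hx s ⟨hs.1, hs.2.trans hST⟩).2.mono (Icc_subset_Icc_right hST)⟩

lemma hasDerivWithinAt_comp_add_const {E : Type*} [NormedAddCommGroup E] [NormedSpace ℝ E]
    {x : ℝ → E} {x' : E} {A B : Set ℝ} {a s : ℝ} (hx : HasDerivWithinAt x x' A (s + a))
    (hB : MapsTo (· + a) B A) : HasDerivWithinAt (fun r => x (r + a)) x' B s := by
  simpa [Function.comp_def] using hx.scomp s ((hasDerivWithinAt_id s B).add_const a) hB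

lemma SolvesOn.shift {S T : ℝ} {x : ℝ → Fin n → ℝ} (hS : 0 ≤ S) (hx : SolvesOn f X (S + T) x) :
    SolvesOn f X T (fun r => x (r + S)) := fun s hs => by
  have hmem : ∀ r ∈ Icc 0 T, r + S ∈ Icc 0 (S + T) := fun r hr =>
    ⟨add_nonneg hr.1 hS, by linarith [hr.2]⟩
  exact ⟨(hx _ (hmem s hs)).1, hasDerivWithinAt_comp_add_const (hx _ (hmem s hs)).2 hmem⟩

/-- Concatenation of two solutions; at the junction the one-sided derivatives agree because both
are given by the vector field. -/
lemma SolvesOn.concat {S T : ℝ} (hS : 0 ≤ S) (hT : 0 ≤ T) {x y : ℝ → Fin n → ℝ}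
    (hx : SolvesOn f X S x) (hy : SolvesOn f X T y) (hxy : x S = y 0) :
    SolvesOn f X (S + T) (fun r => if r ≤ S then x r else y (r - S)) := by
  set w : ℝ → Fin n → ℝ := fun r => if r ≤ S then x r else y (r - S)
  have hw₁ : ∀ r ∈ Icc 0 S, w r = x r := fun r hr => if_pos hr.2
  have hw₂ : ∀ r ∈ Icc S (S + T), w r = y (r + -S) := fun r hr => by
    rcases hr.1.eq_or_lt with rfl | hlt
    · simp [w, hxy]
    · simp [w, hlt.not_ge, sub_eq_add_neg]
  have hd₁ : ∀ s ∈ Icc 0 S, w s ∈ X ∧ HasDerivWithinAt w (f (w s)) (Icc 0 S) s := fun s hs => by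
    rw [hw₁ s hs]
    exact ⟨(hx s hs).1, (hx s hs).2.congr hw₁ (hw₁ s hs)⟩
  have hd₂ : ∀ s ∈ Icc S (S + T), w s ∈ X ∧ HasDerivWithinAt w (f (w s)) (Icc S (S + T)) s :=
      fun s hs => by
    have hmem : ∀ r ∈ Icc S (S + T), r + -S ∈ Icc 0 T := fun r hr =>
      ⟨by linarith [hr.1], by linarith [hr.2]⟩
    rw [hw₂ s hs]
    exact ⟨(hy _ (hmem s hs)).1,
      (hasDerivWithinAt_comp_add_const (hy _ (hmem s hs)).2 hmem).congr hw₂ (hw₂ s hs)⟩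
  have hunion : Icc (0 : ℝ) (S + T) = Icc 0 S ∪ Icc S (S + T) :=
    (Icc_union_Icc_eq_Icc hS (by linarith)).symm
  intro s hs
  -- Away from the junction, the other interval is closed and does not contain `s`.
  have hout : ∀ {a b : ℝ}, s ∉ Icc a b → HasDerivWithinAt w (f (w s)) (Icc a b) s := fun h =>
    HasFDerivWithinAt.of_notMem_closure (by rwa [isClosed_Icc.closure_eq])
  rw [hunion] at hs ⊢
  refine ⟨hs.elim (fun h => (hd₁ s h).1) fun h => (hd₂ s h).1, HasDerivWithinAt.union ?_ ?_⟩
  · by_cases h : s ∈ Icc 0 S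
    · exact (hd₁ s h).2
    · exact hout h
  · by_cases h : s ∈ Icc S (S + T)
    · exact (hd₂ s h).2
    · exact hout h

lemma contFlow_add_iff (s t : ℝ≥0) (ξ w : Fin n → ℝ) :
    contFlow f X (s + t) ξ w ↔ ∃ y, contFlow f X s ξ y ∧ contFlow f X t y w := by
  constructor
  · rintro ⟨x, hx, rfl, rfl⟩
    rw [NNReal.coe_add] at hx
    exact ⟨x s, ⟨x, hx.mono (by simp), rfl, rfl⟩,
      fun r => x (r + s), hx.shift s.2, by simp, by simp [add_comm]⟩
  · rintro ⟨_, ⟨x, hx, rfl, rfl⟩, y, hy, hxy, rfl⟩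
    refine ⟨_, by rw [NNReal.coe_add]; exact hx.concat s.coe_nonneg t.coe_nonneg hy hxy.symm,
      if_pos s.coe_nonneg, ?_⟩
    rcases eq_zero_or_pos t with rfl | ht
    · simp [hxy]
    · simp [(NNReal.coe_pos.2 ht).not_ge]

lemma contFlow_zero {ξ : Fin n → ℝ} (hξ : ξ ∈ X) : contFlow f X 0 ξ ξ := by
  refine ⟨fun _ => ξ, fun s hs => ⟨hξ, ?_⟩, rfl, rfl⟩
  -- On the degenerate interval `[0, 0]` every vector is a derivative.
  rw [NNReal.coe_zero, Icc_self] at hs ⊢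
  rw [mem_singleton_iff.1 hs]
  exact HasFDerivWithinAt.singleton

lemma contFlow_exists_mono {s t : ℝ≥0} (hst : s ≤ t) {ξ : Fin n → ℝ}
    (h : ∃ y, contFlow f X t ξ y) : ∃ y, contFlow f X s ξ y := by
  obtain ⟨_, x, hx, h0, -⟩ := h
  exact ⟨x s, x, hx.mono (NNReal.coe_le_coe.2 hst), h0, rfl⟩

/-- Picard–Lindelöf with a uniform time: the local flow near `p` is jointly continuous, so it
stays in the open set `X` for initial states close to `p` and a short common time. -/
lemma exists_eventually_contFlow (hX : IsOpen X) (hf : ContDiffOn ℝ 1 f X) {p : Fin n → ℝ}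
    (hp : p ∈ X) : ∃ ε > (0 : ℝ≥0), ∀ᶠ ξ in 𝓝 p, ∃ y, contFlow f X ε ξ y := by
  obtain ⟨ε, hε, a, r, L, K, hr, hpl⟩ :=
    IsPicardLindelof.of_contDiffAt_one (hf.contDiffAt (hX.mem_nhds hp))
  obtain ⟨α, hα, hcont⟩ := (hpl 0).exists_forall_mem_closedBall_eq_hasDerivWithinAt_continuousOn
  have hr' : (0 : ℝ) < r := hr
  have hnhds : Metric.closedBall p r ×ˢ Icc (0 - ε) (0 + ε) ∈ 𝓝 (p, (0 : ℝ)) :=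
    prod_mem_nhds (Metric.closedBall_mem_nhds p hr') (Icc_mem_nhds (by linarith) (by linarith))
  have hα0 : α (p, 0) = p := (hα p (Metric.mem_closedBall_self hr'.le)).1
  have hev : ∀ᶠ q in 𝓝 (p, (0 : ℝ)), α q ∈ X :=
    (hcont.continuousAt hnhds).eventually (hX.mem_nhds (by rwa [hα0]))
  rw [nhds_prod_eq] at hev
  obtain ⟨P, hP, Q, hQ, hPQ⟩ := eventually_prod_iff.1 hev
  obtain ⟨δ, hδ, hδQ⟩ := Metric.eventually_nhds_iff.1 hQ
  have hη : 0 < min ε (δ / 2) := lt_min hε (half_pos hδ)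
  refine ⟨⟨min ε (δ / 2), hη.le⟩, hη, ?_⟩
  filter_upwards [hP, Metric.closedBall_mem_nhds p hr'] with ξ hξP hξ
  refine ⟨_, fun s => α (ξ, s), fun s hs => ?_, (hα ξ hξ).1, rfl⟩
  have hs2 : s ≤ min ε (δ / 2) := hs.2
  have hsub : Icc 0 (min ε (δ / 2)) ⊆ Icc (0 - ε) (0 + ε) :=
    Icc_subset_Icc (by linarith) (by rw [zero_add]; exact min_le_left _ _)
  refine ⟨hPQ hξP (hδQ ?_), ((hα ξ hξ).2 s (hsub hs)).mono hsub⟩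
  rw [Real.dist_eq, sub_zero, abs_of_nonneg hs.1]
  linarith [min_le_right ε (δ / 2)]

lemma exists_contFlow_of_isCompact (hX : IsOpen X) (hf : ContDiffOn ℝ 1 f X)
    {K : Set (Fin n → ℝ)} (hK : IsCompact K) (hKX : K ⊆ X) :
    ∃ ε > (0 : ℝ≥0), ∀ ξ ∈ K, ∃ y, contFlow f X ε ξ y := by
  refine hK.induction_on (p := fun K => ∃ ε > (0 : ℝ≥0), ∀ ξ ∈ K, ∃ y, contFlow f X ε ξ y)
    ⟨1, one_pos, by simp⟩ ?_ ?_ ?_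
  · rintro s t hst ⟨ε, hε, h⟩
    exact ⟨ε, hε, fun ξ hξ => h ξ (hst hξ)⟩
  · rintro s t ⟨ε, hε, h⟩ ⟨η, hη, h'⟩
    refine ⟨min ε η, lt_min hε hη, ?_⟩
    rintro ξ (hξ | hξ)
    · exact contFlow_exists_mono (min_le_left _ _) (h ξ hξ)
    · exact contFlow_exists_mono (min_le_right _ _) (h' ξ hξ)
  · intro p hp
    obtain ⟨ε, hε, h⟩ := exists_eventually_contFlow hX hf (hKX hp)
    exact ⟨_, mem_nhdsWithin_of_mem_nhds h, ε, hε, fun ξ hξ => hξ⟩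

lemma isLocalFlow_contFlow (hX : IsOpen X) (hf : ContDiffOn ℝ 1 f X) :
    IsLocalFlow X (contFlow f X) where
  zero _ := contFlow_zero
  add_iff := contFlow_add_iff
  exists_of_isCompact K hK hKX ξ hξ hsub t := by
    obtain ⟨ε, hε, h⟩ := exists_contFlow_of_isCompact hX hf hK hKX
    have hstep : ∀ k : ℕ, ∃ y, contFlow f X (k • ε) ξ y := by
      intro k
      induction k with
      | zero => exact ⟨ξ, by rw [zero_nsmul]; exact contFlow_zero hξ⟩
      | succ k ih =>
        obtain ⟨y, hy⟩ := ih
        obtain ⟨w, hw⟩ := h y (hsub ⟨_, hy⟩)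
        exact ⟨w, by rw [succ_nsmul]; exact (contFlow_add_iff _ _ _ _).2 ⟨y, hy, hw⟩⟩
    obtain ⟨k, hk⟩ := Archimedean.arch t hε
    exact contFlow_exists_mono hk (hstep k)

end KTop

theorem mainTheorem1 {n : ℕ} (X : Set (Fin n → ℝ)) (hXopen : IsOpen X) (hXconv : Convex ℝ X)
    (f : (Fin n → ℝ) → (Fin n → ℝ)) (hf : ContDiffOn ℝ 1 f X) :
    (KTop.KTopical (KTop.contFlow f X) →
      (KTop.equilibria (KTop.contFlow f X)).Nonempty →
      ∀ ξ ∈ X, closure (KTop.trajectory (KTop.contFlow f X) ξ) ⊆ X →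
        ∃ e ∈ KTop.equilibria (KTop.contFlow f X),
          KTop.IsStable X (KTop.contFlow f X) e ∧ KTop.ConvergesTo (KTop.contFlow f X) ξ e) ∧
    (Set.MapsTo f X X →
      KTop.KTopical (KTop.discFlow f X) →
      (KTop.equilibria (KTop.discFlow f X)).Nonempty →
      ∀ ξ ∈ X, closure (KTop.trajectory (KTop.discFlow f X) ξ) ⊆ X →
        ∃ e ∈ KTop.equilibria (KTop.discFlow f X),
          KTop.IsStable X (KTop.discFlow f X) e ∧ KTop.ConvergesTo (KTop.discFlow f X) ξ e) := by
  refine ⟨fun h hne ξ hξ hcl => ?_, fun hmaps h hne ξ hξ hcl => ?_⟩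
  · exact h.exists_isStable_convergesTo (KTop.isLocalFlow_contFlow hXopen hf) hXopen hne hξ hcl
  · exact h.exists_isStable_convergesTo (KTop.isLocalFlow_discFlow hmaps) hXopen hne hξ hcl
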